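/- Let $(\mathcal{C},J)$ be a small site such that $\mathcal{C}$ has pullbacks and the $J$-covering sieves are finitely generated, in the sense that every $J$-covering sieve contains a $J$-covering sieve generated by a finite (possibly empty) family of morphisms (sheaf toposes on sites of this kind are the locally coherent toposes). Then, assuming Zorn's Lemma, the topos $\mathrm{Sh}(\mathcal{C},J)$ of sheaves of sets has enough points: there is a set of points of $\mathrm{Sh}(\mathcal{C},J)$, that is, of geometric morphisms $p:\mathrm{Set}\to\mathrm{Sh}(\mathcal{C},J)$, such that a morphism $f$ of $\mathrm{Sh}(\mathcal{C},J)$ is an isomorphism as soon as $p^*(f)$ is a bijection for every $p$ in this set. -/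

import Mathlib

open CategoryTheory CategoryTheory.Limits

universe u w v' u'

/-- A point of a topos `E`: a geometric morphism from the topos of sets to `E`, that is, an
inverse image functor `p^* : E ⥤ Type w` which preserves finite limits, together with a
direct image functor `p_*` that is right adjoint to it. -/
structure ToposPoint (E : Type u') [Category.{v'} E] where
  /-- the inverse image functor `p^*` -/
  inverseImage : E ⥤ Type w
  /-- the direct image functor `p_*` -/
  directImage : Type w ⥤ E
  /-- the inverse image is left adjoint to the direct image -/
  adj : inverseImage ⊣ directImage
  /-- the inverse image is left exact -/
  preservesFiniteLimits : PreservesFiniteLimits inverseImage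

/-- A topos `E` has enough points if there is a (`w`-small) set of points of `E` whose inverse
image functors are jointly conservative: a morphism of `E` is an isomorphism as soon as
all of its images under these functors are bijections. -/
def ToposHasEnoughPoints (E : Type u') [Category.{v'} E] : Prop :=
  ∃ (ι : Type w) (p : ι → ToposPoint.{w} E),
    JointlyReflectIsomorphisms (fun i => (p i).inverseImage)

/-- A sieve is finitely generated if it is generated by a finite (possibly empty) family of
morphisms. -/
def SieveFinitelyGenerated {C : Type u'} [Category.{v'} C] {X : C} (S : Sieve X) : Prop :=
  ∃ (n : ℕ) (Y : Fin n → C) (f : ∀ i, Y i ⟶ X), S = Sieve.ofArrows Y f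

/-- The covering sieves of the topology `J` are finitely generated, in the sense appropriate to
a family of sieves that is closed under enlargement: every covering sieve contains a covering
sieve which is finitely generated. -/
def CoveringSievesFinitelyGenerated {C : Type u'} [Category.{v'} C]
    (J : GrothendieckTopology C) : Prop :=
  ∀ (X : C), ∀ S ∈ J X, ∃ T ∈ J X, T ≤ S ∧ SieveFinitelyGenerated T

/-! It suffices to find, for each non-covering sieve `S` on `X`, a point with an element over `X`
that does not lift along `S`. In the slice over `X`, let `B` consist of the objects on which `S`
becomes covering: it is stable under restriction, local, and omits the terminal object. Left exact
functors avoiding `B` are enlarged until every element lifts along every covering sieve.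

A single lift is adjoined by base change of a pro-object; were every generator of a finite cover to
lead into `B`, locality would put a stage of the pro-object in `B`. An ultraproduct (the use of
choice) handles all lifts at once, and iterating countably often gives a point of the slice
(`exists_point_avoids`), which is then pushed forward to the site. -/

namespace CategoryTheory

section Lifts

variable {D : Type u'} [Category.{v'} D]

/-- A set-valued functor avoids a class of objects if its values there are empty. -/
def Functor.Avoids (F : D ⥤ Type w) (B : ObjectProperty D) : Prop :=
  ∀ ⦃Y : D⦄, F.obj Y → ¬ B Y

/-- An element of `F.obj Y` lifts along a sieve `R` on `Y` if it is in the image of `F.map f`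
for some `f` in `R`. -/
def Functor.LiftsAlong (F : D ⥤ Type w) {Y : D} (y : F.obj Y) (R : Sieve Y) : Prop :=
  ∃ (Z : D) (f : Z ⟶ Y) (_ : R f) (z : F.obj Z), F.map f z = y

lemma Functor.LiftsAlong.map {F G : D ⥤ Type w} {Y : D} {y : F.obj Y} {R : Sieve Y}
    (h : F.LiftsAlong y R) (φ : F ⟶ G) : G.LiftsAlong (φ.app Y y) R := by
  obtain ⟨Z, f, hf, z, rfl⟩ := h
  exact ⟨Z, f, hf, φ.app Z z, (NatTrans.naturality_apply φ f z).symm⟩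

end Lifts

instance initiallySmall_of_smallCategory (N : Type u) [SmallCategory N] : InitiallySmall.{u} N :=
  initiallySmall_of_essentiallySmall _

/-! ### Adjoining one lift by base change -/

section BaseChange

variable {D : Type u} [SmallCategory D] [HasPullbacks D] {N : Type u} [SmallCategory N]
  (p : N ⥤ D) {i : N} {Y Z : D} (y : p.obj i ⟶ Y) (f : Z ⟶ Y)

/-- The base change along `f : Z ⟶ Y` of a pro-object `p : N ⥤ D` with a morphism to `Y`,
given at the stage `i : N` by `y : p.obj i ⟶ Y`. -/
noncomputable def Functor.baseChange : Over i ⥤ D where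
  obj e := pullback (p.map e.hom ≫ y) f
  map {e e'} g := pullback.lift (pullback.fst _ _ ≫ p.map g.left) (pullback.snd _ _) (by
    rw [Category.assoc, ← p.map_comp_assoc, Over.w, pullback.condition])
  map_id _ := pullback.hom_ext (by simp) (by simp)
  map_comp _ _ := pullback.hom_ext
    ((pullback.lift_fst _ _ _).trans (by
      rw [Category.assoc, pullback.lift_fst, pullback.lift_fst_assoc, Over.comp_left, p.map_comp,
        Category.assoc]))
    ((pullback.lift_snd _ _ _).trans (by
      rw [Category.assoc, pullback.lift_snd, pullback.lift_snd]))

/-- The projection from the base change of a pro-object to this pro-object. -/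
noncomputable def Functor.baseChangeFst (e : Over i) : (p.baseChange y f).obj e ⟶ p.obj e.left :=
  pullback.fst (p.map e.hom ≫ y) f

lemma Functor.baseChange_map_fst_assoc {e e' : Over i} (g : e ⟶ e') {W : D}
    (h : p.obj e'.left ⟶ W) :
    (p.baseChange y f).map g ≫ p.baseChangeFst y f e' ≫ h =
      p.baseChangeFst y f e ≫ p.map g.left ≫ h :=
  (pullback.lift_fst_assoc _ _ _ _).trans (Category.assoc _ _ _)

/-- The projection from the base change of a pro-object along `f : Z ⟶ Y` to `Z`. -/
noncomputable def Functor.baseChangeSnd (e : Over i) : (p.baseChange y f).obj e ⟶ Z :=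
  pullback.snd (p.map e.hom ≫ y) f

lemma Functor.baseChange_condition (e : Over i) :
    p.baseChangeFst y f e ≫ p.map e.hom ≫ y = p.baseChangeSnd y f e ≫ f :=
  pullback.condition

open GrothendieckTopology.Point.ofIsCofiltered

variable [IsCofiltered N]

/-- Makes `fiberToBaseChange` independent of representatives: a stage where `g` and `g'` agree can
itself be taken over `i`. -/
lemma Functor.fiberMk_baseChangeFst_eq {W : D} {e e' : Over i} {g : p.obj e.left ⟶ W}
    {g' : p.obj e'.left ⟶ W} (h : fiberMk.{u} g = fiberMk.{u} g') :
    fiberMk.{u} (p.baseChangeFst y f e ≫ g) =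
      fiberMk.{u} (p.baseChangeFst y f e' ≫ g') := by
  let a := (IsCofiltered.minToLeft e e').left
  let a' := (IsCofiltered.minToRight e e').left
  rw [← fiberMk_map_comp p a, ← fiberMk_map_comp p a'] at h
  obtain ⟨V, v, hv⟩ := exists_of_fiberMk_eq_fiberMk h
  let b : Over.mk (v ≫ (IsCofiltered.min e e').hom) ⟶ IsCofiltered.min e e' := Over.homMk v
  rw [← fiberMk_map_comp _ (b ≫ IsCofiltered.minToLeft e e'),
    ← fiberMk_map_comp _ (b ≫ IsCofiltered.minToRight e e'),
    Functor.baseChange_map_fst_assoc, Functor.baseChange_map_fst_assoc]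
  congr 2
  simpa [a, a', b] using hv

omit [HasPullbacks D] in
lemma exists_fiberMk_over (i : N) {p : N ⥤ D} {W : D} (w : (fiber.{u} p).obj W) :
    ∃ (e : Over i) (g : p.obj e.left ⟶ W), fiberMk g = w := by
  obtain ⟨U, g, rfl⟩ := fiberMk_jointly_surjective w
  exact ⟨Over.mk (IsCofiltered.minToLeft i U), p.map (IsCofiltered.minToRight i U) ≫ g,
    fiberMk_map_comp ..⟩

/-- The transformation between pro-represented functors that is induced by the projection from
the base change of a pro-object. -/
noncomputable def Functor.fiberToBaseChange : fiber.{u} p ⟶ fiber.{u} (p.baseChange y f) where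
  app W := ↾fun w ↦ fiberMk (p.baseChangeFst y f _ ≫
    (exists_fiberMk_over i w).choose_spec.choose)
  naturality W W' h := by
    ext w
    have hw := (exists_fiberMk_over i w).choose_spec.choose_spec
    have hw' := (exists_fiberMk_over i ((fiber.{u} p).map h w)).choose_spec.choose_spec
    refine Eq.trans ?_ (fiber_map_fiberMk _ _ _).symm
    rw [Category.assoc]
    exact p.fiberMk_baseChangeFst_eq y f (hw'.trans
      ((congr_arg _ hw.symm).trans (fiber_map_fiberMk _ _ _)))

lemma Functor.fiberToBaseChange_app_fiberMk {W : D} (e : Over i) (g : p.obj e.left ⟶ W) :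
    (p.fiberToBaseChange y f).app W (fiberMk g) =
      fiberMk (p.baseChangeFst y f e ≫ g) :=
  p.fiberMk_baseChangeFst_eq y f (exists_fiberMk_over i _).choose_spec.choose_spec

lemma Functor.fiber_baseChange_liftsAlong {R : Sieve Y} (hf : R f) :
    (fiber.{u} (p.baseChange y f)).LiftsAlong
      ((p.fiberToBaseChange y f).app Y (fiberMk y)) R := by
  refine ⟨Z, f, hf, fiberMk (p.baseChangeSnd y f (Over.mk (𝟙 i))), ?_⟩
  have h := p.fiberToBaseChange_app_fiberMk y f (Over.mk (𝟙 i)) (p.map (𝟙 i) ≫ y)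
  rw [fiberMk_map_comp] at h
  rw [h, fiber_map_fiberMk, ← p.baseChange_condition]
  rfl

-- For the trivial topology every cofiltered pro-object is a point, so its fiber functor is left
-- exact.
omit [HasPullbacks D] in
lemma preservesFiniteLimits_fiber (p : N ⥤ D) : PreservesFiniteLimits (fiber.{u} p) :=
  inferInstanceAs (PreservesFiniteLimits
    (GrothendieckTopology.Point.ofIsCofiltered (J := (⊥ : GrothendieckTopology D)) p (by
      intro X R hR U g
      rw [GrothendieckTopology.bot_covering] at hR
      exact ⟨_, g, by simp [hR], U, 𝟙 _, 𝟙 _, by simp⟩)).fiber)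

/-- Given an element of a pro-representable functor avoiding a class of objects that is local
for a topology, one can adjoin a lift of this element along some member of a finitely generated
covering sieve and still avoid this class. -/
lemma exists_liftsAlong_of_avoids {K : GrothendieckTopology D}
    {B : ObjectProperty D} (hres : ∀ ⦃Y Z : D⦄, (Z ⟶ Y) → B Y → B Z)
    (hloc : ∀ ⦃Y : D⦄, ∀ R ∈ K Y, (∀ ⦃Z : D⦄ (f : Z ⟶ Y), R f → B Z) → B Y)
    {p : N ⥤ D} (hp : ∀ i, ¬ B (p.obj i)) {i : N} {Y : D} (y : p.obj i ⟶ Y)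
    {R : Sieve Y} (hR : R ∈ K Y) (hR' : SieveFinitelyGenerated R) :
    ∃ (G : D ⥤ Type u) (_ : PreservesFiniteLimits G) (_ : G.Avoids B) (φ : fiber.{u} p ⟶ G),
      G.LiftsAlong (φ.app Y (fiberMk y)) R := by
  obtain ⟨n, Z, f, rfl⟩ := hR'
  by_cases! H : ∃ k, (fiber.{u} (p.baseChange y (f k))).Avoids B
  · obtain ⟨k, hk⟩ := H
    exact ⟨_, preservesFiniteLimits_fiber _, hk, p.fiberToBaseChange y (f k),
      p.fiber_baseChange_liftsAlong y (f k) (Sieve.ofArrows_mk _ _ _)⟩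
  exfalso
  have : ∀ k, ∃ e : Over i, B ((p.baseChange y (f k)).obj e) := by
    intro k
    have hk := H k
    simp only [Functor.Avoids, not_forall, not_not] at hk
    obtain ⟨W, w, hW⟩ := hk
    obtain ⟨e, g, -⟩ := fiberMk_jointly_surjective w
    exact ⟨e, hres g hW⟩
  choose e he using this
  classical
  obtain ⟨e₀, he₀⟩ := IsCofiltered.inf_objs_exists (Finset.univ.image e)
  refine hp e₀.left (hloc _ (K.pullback_stable (p.map e₀.hom ≫ y) hR) fun V g hg ↦ ?_)
  obtain ⟨W, a, _, ⟨k⟩, h⟩ := hg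
  obtain ⟨b⟩ := he₀ (Finset.mem_image_of_mem e (Finset.mem_univ k))
  exact hres (pullback.lift g a h.symm) (hres ((p.baseChange y (f k)).map b) (he k))

end BaseChange

section

variable {D : Type u} [SmallCategory D] (F : D ⥤ Type u)

open GrothendieckTopology.Point.ofIsCofiltered

/-- The canonical transformation from a functor `F` to the functor that is pro-represented by
the elements of `F`. -/
noncomputable def Functor.toFiberElements : F ⟶ fiber.{u} (CategoryOfElements.π F) where
  app W := ↾fun w ↦ fiberMk (p := CategoryOfElements.π F) (U := F.elementsMk W w) (𝟙 W)
  naturality W W' h := by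
    ext w
    let a : F.elementsMk W w ⟶ F.elementsMk W' (F.map h w) := ⟨h, rfl⟩
    refine Eq.trans ?_ (fiber_map_fiberMk (p := CategoryOfElements.π F) (U := F.elementsMk W w)
      (𝟙 W) h).symm
    refine (fiberMk_map (CategoryOfElements.π F) a).symm.trans ?_
    congr 1
    exact (Category.id_comp h).symm

-- Left exactness makes the category of elements cofiltered, so `F` maps to a functor
-- pro-represented by objects on which `F` is inhabited, hence outside `B`.
variable {F} in
lemma Functor.Avoids.exists_liftsAlong [HasFiniteLimits D] [PreservesFiniteLimits F]
    {K : GrothendieckTopology D}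
    {B : ObjectProperty D} (hres : ∀ ⦃Y Z : D⦄, (Z ⟶ Y) → B Y → B Z)
    (hloc : ∀ ⦃Y : D⦄, ∀ R ∈ K Y, (∀ ⦃Z : D⦄ (f : Z ⟶ Y), R f → B Z) → B Y)
    (hF : F.Avoids B) {Y : D} (y : F.obj Y) {R : Sieve Y} (hR : R ∈ K Y)
    (hR' : SieveFinitelyGenerated R) :
    ∃ (G : D ⥤ Type u) (_ : PreservesFiniteLimits G) (_ : G.Avoids B) (φ : F ⟶ G),
      G.LiftsAlong (φ.app Y y) R := by
  have := F.isCofiltered_elements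
  obtain ⟨G, hG, hG', φ, hφ⟩ := exists_liftsAlong_of_avoids hres hloc
    (p := CategoryOfElements.π F) (fun e ↦ hF e.2) (i := F.elementsMk Y y) (𝟙 Y) hR hR'
  exact ⟨G, hG, hG', F.toFiberElements ≫ φ, hφ⟩

end

open Opposite

/-! ### Ultraproducts of left exact functors -/

section Ultraproduct

variable {D : Type u} [SmallCategory D] {τ : Type u} (G : τ → D ⥤ Type u)

/-- The product of the functors `G t` for `t` in the set `A`. -/
@[simps]
def Functor.piOn (A : Set τ) : D ⥤ Type u where
  obj W := ∀ t : A, (G t).obj W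
  map f := ↾fun x t ↦ (G t).map f (x t)

/-- The transformation to a product that is induced by transformations to its factors. -/
def Functor.toPiOn (A : Set τ) {F : D ⥤ Type u} (φ : ∀ t, F ⟶ G t) : F ⟶ Functor.piOn G A where
  app W := ↾fun w t ↦ (φ t).app W w
  naturality W W' f := by
    ext w
    exact funext fun t ↦ NatTrans.naturality_apply (φ t) f w

instance (A : Set τ) [∀ t, PreservesFiniteLimits (G t)] :
    PreservesFiniteLimits (Functor.piOn G A) where
  preservesFiniteLimits S _ _ := ⟨fun {K} ↦ ⟨fun {c} hc ↦ by
    rw [Types.isLimit_iff]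
    intro s hs
    have h (t : A) := (Types.isLimit_iff _).1 ⟨isLimitOfPreserves (G t) hc⟩
      (fun j ↦ s j t) (fun f ↦ congr_fun (hs f) t)
    choose x hx hx' using h
    exact ⟨x, fun j ↦ funext fun t ↦ hx t j,
      fun y hy ↦ funext fun t ↦ hx' t (y t) fun j ↦ congr_fun (hy j) t⟩⟩⟩

/-- The inverse system of the sets of an ultrafilter gives a filtered diagram of products. -/
def Functor.ultraproductDiagram (U : Ultrafilter τ) : {A : Set τ // A ∈ U}ᵒᵖ ⥤ D ⥤ Type u where
  obj A := Functor.piOn G A.unop.1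
  map f := { app W := ↾fun x t ↦ x ⟨t.1, leOfHom f.unop t.2⟩ }

instance (U : Ultrafilter τ) : IsCofiltered {A : Set τ // A ∈ U} where
  nonempty := ⟨⟨Set.univ, Filter.univ_mem⟩⟩
  cone_objs A A' := ⟨⟨A.1 ∩ A'.1, Filter.inter_mem A.2 A'.2⟩,
    homOfLE Set.inter_subset_left, homOfLE Set.inter_subset_right, trivial⟩
  cone_maps A _ _ _ := ⟨A, 𝟙 _, Subsingleton.elim _ _⟩

/-- The ultraproduct of a family of set-valued functors, as the colimit of the products over
the sets in the ultrafilter. -/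
noncomputable def Functor.ultraproduct (U : Ultrafilter τ) : D ⥤ Type u :=
  colimit (Functor.ultraproductDiagram G U)

/-- The projection to the ultraproduct from a product over a set in the ultrafilter. -/
noncomputable def Functor.toUltraproduct (U : Ultrafilter τ) {A : Set τ} (hA : A ∈ U) :
    Functor.piOn G A ⟶ Functor.ultraproduct G U :=
  colimit.ι (Functor.ultraproductDiagram G U) (op ⟨A, hA⟩)

lemma Functor.toUltraproduct_restrict (U : Ultrafilter τ) {A A' : Set τ} (hA : A ∈ U)
    (hA' : A' ∈ U) (h : A ⊆ A') {W : D} (x : ∀ t : A', (G t).obj W) :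
    (Functor.toUltraproduct G U hA).app W (fun t ↦ x ⟨t.1, h t.2⟩) =
      (Functor.toUltraproduct G U hA').app W x :=
  ConcreteCategory.congr_hom (NatTrans.congr_app
    (colimit.w (Functor.ultraproductDiagram G U)
      (homOfLE h : (⟨A, hA⟩ : {A : Set τ // A ∈ U}) ⟶ ⟨A', hA'⟩).op) W) x

lemma exists_colimit_ι_app {N : Type w} [Category.{v'} N] [HasColimitsOfShape N (Type u)]
    (H : N ⥤ D ⥤ Type u) {W : D}
    (w : (colimit H).obj W) : ∃ (n : N) (x : (H.obj n).obj W), (colimit.ι H n).app W x = w :=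
  Types.jointly_surjective_of_isColimit
    (isColimitOfPreserves ((evaluation D (Type u)).obj W) (colimit.isColimit H)) w

lemma preservesFiniteLimits_colimit {N : Type w} [Category.{v'} N]
    [HasColimitsOfShape N (Type u)] [HasExactColimitsOfShape N (Type u)] (H : N ⥤ D ⥤ Type u)
    (hH : ∀ n, PreservesFiniteLimits (H.obj n)) :
    PreservesFiniteLimits (colimit H) :=
  ObjectProperty.prop_of_isColimit (P := ObjectProperty.preservesFiniteLimits)
    (colimit.isColimit H) hH

instance (U : Ultrafilter τ) [∀ t, PreservesFiniteLimits (G t)] :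
    PreservesFiniteLimits (Functor.ultraproduct G U) :=
  preservesFiniteLimits_colimit _ fun A ↦
    inferInstanceAs (PreservesFiniteLimits (Functor.piOn G A.unop.1))

variable {G}

lemma Functor.Avoids.ultraproduct {B : ObjectProperty D} (h : ∀ t, (G t).Avoids B)
    (U : Ultrafilter τ) : (Functor.ultraproduct G U).Avoids B := by
  intro Y y
  obtain ⟨A, x, -⟩ := exists_colimit_ι_app _ y
  obtain ⟨t, ht⟩ := U.nonempty_of_mem A.unop.2
  exact h t (x ⟨t, ht⟩)

/-- An ultrafilter selects one of finitely many generators that works for almost all `t`. -/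
lemma Functor.ultraproduct_liftsAlong {U : Ultrafilter τ} {Y : D} (y : ∀ t, (G t).obj Y)
    {R : Sieve Y} (hR : SieveFinitelyGenerated R) (h : ∀ᶠ t in U, (G t).LiftsAlong (y t) R) :
    (Functor.ultraproduct G U).LiftsAlong
      ((Functor.toUltraproduct G U Filter.univ_mem).app Y fun t ↦ y t) R := by
  obtain ⟨n, Z, f, rfl⟩ := hR
  have h' : ∀ᶠ t in U, ∃ k, ∃ z, (G t).map (f k) z = y t := by
    filter_upwards [h] with t ht
    obtain ⟨V, g, ⟨W, a, _, ⟨k⟩, rfl⟩, z, hz⟩ := ht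
    exact ⟨k, (G t).map a z, by rw [← hz, Functor.map_comp_apply]⟩
  obtain ⟨k, hk⟩ := Ultrafilter.eventually_exists_iff.1 h'
  let A : Set τ := {t | ∃ z, (G t).map (f k) z = y t}
  replace hk : A ∈ U := hk
  choose z hz using fun t : A ↦ t.2
  refine ⟨Z k, f k, Sieve.ofArrows_mk _ _ _, (Functor.toUltraproduct G U hk).app _ z, ?_⟩
  refine (NatTrans.naturality_apply (Functor.toUltraproduct G U hk) (f k) z).symm.trans ?_
  refine Eq.trans ?_
    (Functor.toUltraproduct_restrict G U hk Filter.univ_mem (Set.subset_univ _) _)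
  exact congr_arg _ (funext hz)

end Ultraproduct

/-! ### Points avoiding a local class -/

section

variable {D : Type u} [SmallCategory D] [HasFiniteLimits D] {K : GrothendieckTopology D}
  {B : ObjectProperty D}

variable (K) in
/-- The elements of `F`, each together with a finitely generated covering sieve. -/
abbrev LiftingProblem (F : D ⥤ Type u) : Type u :=
  Σ Y : D, F.obj Y × {R : Sieve Y // R ∈ K Y ∧ SieveFinitelyGenerated R}

lemma Functor.Avoids.exists_liftsAlong_finset (hres : ∀ ⦃Y Z : D⦄, (Z ⟶ Y) → B Y → B Z)
    (hloc : ∀ ⦃Y : D⦄, ∀ R ∈ K Y, (∀ ⦃Z : D⦄ (f : Z ⟶ Y), R f → B Z) → B Y)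
    {F : D ⥤ Type u} [PreservesFiniteLimits F] (hF : F.Avoids B)
    (s : Finset (LiftingProblem K F)) :
    ∃ (G : D ⥤ Type u) (_ : PreservesFiniteLimits G) (_ : G.Avoids B) (φ : F ⟶ G),
      ∀ q ∈ s, G.LiftsAlong (φ.app q.1 q.2.1) q.2.2.1 := by
  classical
  induction s using Finset.induction_on with
  | empty => exact ⟨F, inferInstance, hF, 𝟙 F, by simp⟩
  | insert q s _ ih =>
    obtain ⟨G, _, hG, φ, hφ⟩ := ih
    obtain ⟨G', hG₁, hG₂, ψ, hψ⟩ :=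
      hG.exists_liftsAlong hres hloc (φ.app q.1 q.2.1) q.2.2.2.1 q.2.2.2.2
    refine ⟨G', hG₁, hG₂, φ ≫ ψ, fun q' hq' ↦ ?_⟩
    obtain rfl | hq' := Finset.mem_insert.1 hq'
    · exact hψ
    · exact (hφ q' hq').map ψ

/-- By compactness, lifts can be adjoined for all elements and all finitely generated covering
sieves at once. -/
lemma Functor.Avoids.exists_liftsAlong_all (hres : ∀ ⦃Y Z : D⦄, (Z ⟶ Y) → B Y → B Z)
    (hloc : ∀ ⦃Y : D⦄, ∀ R ∈ K Y, (∀ ⦃Z : D⦄ (f : Z ⟶ Y), R f → B Z) → B Y)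
    {F : D ⥤ Type u} [PreservesFiniteLimits F] (hF : F.Avoids B) :
    ∃ (G : D ⥤ Type u) (_ : PreservesFiniteLimits G) (_ : G.Avoids B) (φ : F ⟶ G),
      ∀ q : LiftingProblem K F, G.LiftsAlong (φ.app q.1 q.2.1) q.2.2.1 := by
  classical
  choose G hG₁ hG₂ φ hφ using hF.exists_liftsAlong_finset (K := K) hres hloc
  -- Refining `atTop` ensures that each problem belongs to almost every finite set.
  let U : Ultrafilter (Finset (LiftingProblem K F)) := Ultrafilter.of Filter.atTop
  refine ⟨Functor.ultraproduct G U, inferInstance, Functor.Avoids.ultraproduct hG₂ U,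
    Functor.toPiOn G _ φ ≫ Functor.toUltraproduct G U Filter.univ_mem,
    fun q ↦ Functor.ultraproduct_liftsAlong (fun t ↦ (φ t).app _ q.2.1) q.2.2.2.2 ?_⟩
  filter_upwards [Ultrafilter.of_le _ (Filter.eventually_ge_atTop {q})] with t ht
  exact hφ t q (ht (Finset.mem_singleton_self q))

/-- Given a class of objects that is closed under restriction and local for a topology whose
covering sieves are finitely generated, there is a point of the site whose fibers at these
objects are empty, as soon as there is an object not in the class. -/
lemma exists_point_avoids (hK : CoveringSievesFinitelyGenerated K)
    (hres : ∀ ⦃Y Z : D⦄, (Z ⟶ Y) → B Y → B Z)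
    (hloc : ∀ ⦃Y : D⦄, ∀ R ∈ K Y, (∀ ⦃Z : D⦄ (f : Z ⟶ Y), R f → B Z) → B Y)
    (hB : ¬ B (⊤_ D)) :
    ∃ Φ : GrothendieckTopology.Point.{u} K, Φ.fiber.Avoids B := by
  let T := {F : D ⥤ Type u // PreservesFiniteLimits F ∧ F.Avoids B}
  have h (F : T) : ∃ (G : T) (φ : F.1 ⟶ G.1),
      ∀ q : LiftingProblem K F.1, G.1.LiftsAlong (φ.app q.1 q.2.1) q.2.2.1 := by
    have := F.2.1
    obtain ⟨G, hG₁, hG₂, φ, hφ⟩ := F.2.2.exists_liftsAlong_all (K := K) hres hloc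
    exact ⟨⟨G, hG₁, hG₂⟩, φ, hφ⟩
  choose next φ hφ using h
  -- A global element of an object of `B` would put the terminal object in `B`.
  let F₀ : T := ⟨coyoneda.obj (op (⊤_ D)), inferInstance, fun Y y hY ↦ hB (hres y hY)⟩
  let X (n : ℕ) : T := Nat.rec F₀ (fun _ ↦ next) n
  let H : ℕ ⥤ D ⥤ Type u := Functor.ofSequence (X := fun n ↦ (X n).1) fun n ↦ φ (X n)
  have : AB5OfSize.{0, 0} (Type u) := AB5OfSize_shrink.{0, 0, u, u} _
  have : PreservesFiniteLimits (colimit H) := preservesFiniteLimits_colimit H fun n ↦ (X n).2.1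
  have := (colimit H).isCofiltered_elements
  refine ⟨⟨colimit H, inferInstance, inferInstance, fun {Y} R hR y ↦ ?_⟩, fun Y y ↦ ?_⟩
  · obtain ⟨S, hS, hSR, hS'⟩ := hK Y R hR
    obtain ⟨n, x, rfl⟩ := exists_colimit_ι_app H y
    -- Problems posed at stage `n` are solved at stage `n + 1`.
    obtain ⟨Z, f, hf, z, hz⟩ := (hφ (X n) ⟨Y, x, S, hS, hS'⟩).map (colimit.ι H (n + 1))
    refine ⟨Z, f, hSR _ hf, z, hz.trans ?_⟩
    have h := colimit.w H (homOfLE n.le_succ)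
    rw [Functor.ofSequence_map_homOfLE_succ] at h
    exact ConcreteCategory.congr_hom (NatTrans.congr_app h Y) x
  · obtain ⟨n, x, -⟩ := exists_colimit_ι_app H y
    exact (X n).2.2 x

end

/-! ### Slices and non-covering sieves -/

/-- Finite generation of covering sieves passes to slice sites. -/
lemma CoveringSievesFinitelyGenerated.over {C : Type u'} [Category.{v'} C]
    {J : GrothendieckTopology C} (hJ : CoveringSievesFinitelyGenerated J) (X : C) :
    CoveringSievesFinitelyGenerated (J.over X) := by
  intro Y S hS
  obtain ⟨T, hT, hTS, n, Z, f, rfl⟩ := hJ Y.left (Sieve.overEquiv Y S) hS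
  let g (i : Fin n) : Over.mk (f i ≫ Y.hom) ⟶ Y := Over.homMk (f i)
  have hg : Sieve.overEquiv Y (Sieve.ofArrows _ g) = Sieve.ofArrows Z f :=
    Sieve.overEquiv_ofArrows _ g
  exact ⟨_, by rwa [J.mem_over_iff, hg], by rwa [← hg, OrderIso.le_iff_le] at hTS, n, _, g, rfl⟩

variable {C : Type u} [SmallCategory C] [HasPullbacks C] {J : GrothendieckTopology C}

open GrothendieckTopology.Point.ofIsCofiltered in
/-- Every sieve that is not covering is missed by an element of a fiber functor. -/
lemma exists_point_not_liftsAlong (hJ : CoveringSievesFinitelyGenerated J) {X : C} {S : Sieve X}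
    (hS : S ∉ J X) :
    ∃ (Φ : GrothendieckTopology.Point.{u} J) (x : Φ.fiber.obj X), ¬ Φ.fiber.LiftsAlong x S := by
  have : HasFiniteLimits (Over X) := hasFiniteLimits_of_hasTerminal_and_pullbacks
  obtain ⟨Φ, hΦ⟩ := exists_point_avoids (hJ.over X)
    (B := fun Y : Over X ↦ S.pullback Y.hom ∈ J Y.left)
    (fun Y Z f hY ↦ by
      rw [← Over.w f, Sieve.pullback_comp]
      exact J.pullback_stable _ hY)
    (fun Y R hR h ↦ J.transitive hR _ fun Z g hg ↦ by
      rw [← Sieve.pullback_comp]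
      exact h _ ((Sieve.overEquiv_iff R g).1 hg))
    (fun h ↦ hS (by
      have := J.pullback_stable (terminal.from (Over.mk (𝟙 X))).left h
      rw [← Sieve.pullback_comp, Over.w] at this
      rwa [← S.pullback_id]))
  let p := CategoryOfElements.π Φ.fiber ⋙ Over.forget X
  -- The structure maps to `X` define one element of the pushed-forward fiber. None lies in `S`, as
  -- `S` would then pull back to the maximal sieve; a lift along `S` would force one to.
  obtain ⟨s, hs, hs'⟩ : ∃ s : ∀ w, p.obj w ⟶ X,
      (∀ {v w} (a : v ⟶ w), p.map a ≫ s w = s v) ∧ ∀ w, ¬ S (s w) :=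
    ⟨fun w ↦ w.1.hom, fun a ↦ Over.w a.1, fun w hw ↦ hΦ w.2
      (J.superset_covering (S.pullback_eq_top_of_mem hw).ge (J.top_mem _))⟩
  let u : Φ.fiber.Elements := Classical.choice IsCofiltered.nonempty
  refine ⟨Φ.map (Over.forget X) J, fiberMk (s u), ?_⟩
  rintro ⟨Z, g, hg, z, hz⟩
  obtain ⟨u', h, rfl⟩ := fiberMk_jointly_surjective z
  have hz' : fiberMk (p.map (IsCofiltered.minToRight u u') ≫ h ≫ g) =
      fiberMk (p.map (IsCofiltered.minToLeft u u') ≫ s u) :=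
    (fiberMk_map_comp p _ (h ≫ g)).trans ((fiber_map_fiberMk (p := p) h g).symm.trans
      (hz.trans (fiberMk_map_comp p _ (s u)).symm))
  obtain ⟨v, b, hb⟩ := exists_of_fiberMk_eq_fiberMk hz'
  rw [hs, hs] at hb
  refine hs' v ?_
  rw [← hb, ← Category.assoc, ← Category.assoc]
  exact S.downward_closed hg _

end CategoryTheory

theorem corollary3p5 (C : Type u) [SmallCategory C] [HasPullbacks C]
    (J : GrothendieckTopology C) (hJ : CoveringSievesFinitelyGenerated J) :
    ToposHasEnoughPoints.{u} (Sheaf J (Type u)) := by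
  choose Φ x hx using fun s : {s : Σ X : C, Sieve X // s.2 ∉ J s.1} ↦
    exists_point_not_liftsAlong hJ s.2
  have h : (ObjectProperty.ofObj Φ).IsConservativeFamilyOfPoints := .mk' fun X S hS ↦ by
    by_contra hS'
    exact hx ⟨⟨X, S⟩, hS'⟩ (hS ⟨_, ObjectProperty.ofObj_apply Φ _⟩ (x ⟨⟨X, S⟩, hS'⟩))
  refine ⟨_, fun s ↦ ⟨(Φ s).sheafFiber, _, (Φ s).skyscraperSheafAdjunction, inferInstance⟩, ⟨?_⟩⟩
  intro F G f hf
  have (Ψ : (ObjectProperty.ofObj Φ).FullSubcategory) : IsIso (Ψ.obj.sheafFiber.map f) := by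
    obtain ⟨_, ⟨s⟩⟩ := Ψ
    exact hf s
  exact h.jointlyReflectIsomorphisms_type.isIso f
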